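/- **Conventions.** A *local topological group* is a Hausdorff space $\mathsf G$ with a unit $e\in\mathsf G$, a neighborhood $\mathcal J(\mathsf G)$ of $e$, an open set $\mathcal D(\mathsf G)\subset \mathsf G\times\mathsf G$ containing $\mathsf G\times\{e\}$ and $\{e\}\times\mathsf G$, and continuous maps $a\mapsto a^{-1}$, $\mathcal J(\mathsf G)\to\mathsf G$, and $(a,b)\mapsto a\cdot b$, $\mathcal D(\mathsf G)\to\mathsf G$, such that: $a\cdot e=e\cdot a=a$ for all $a$; $a_1\cdot(a\cdot a_2)=(a_1\cdot a)\cdot a_2$ whenever all four products are defined; and for $b\in\mathcal J(\mathsf G)$ the products $b\cdot b^{-1}$ and $b^{-1}\cdot b$ are defined and equal $e$. For an open set $\mathcal U\ni e$ let $\mathcal D(\mathcal U)=\{(a,b)\in\mathcal D(\mathsf G): a,b,a\cdot b\in\mathcal U\}$. As usual, $\mathsf G$ itself and every neighborhood $\mathcal U$ of the unit considered below are assumed open, *symmetric* (every $a\in\mathcal U$ has an inverse $a^{-1}$, and $a^{-1}\in\mathcal U$) and *cancellative* (for pairs in $\mathcal D(\mathcal U)$, $a\cdot a_1=a\cdot a_2$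 or $a_1\cdot a=a_2\cdot a$ implies $a_1=a_2$; and $(a_1,a_2)\in\mathcal D(\mathcal U)$ implies $(a_2^{-1},a_1^{-1})\in\mathcal D(\mathcal U)$ and $(a_1\cdot a_2)^{-1}=a_2^{-1}\cdot a_1^{-1}$). A *subgroup* of $\mathsf G$ is a subset $\mathsf H\ni e$ with $\mathsf H\times\mathsf H\subset\mathcal D(\mathsf G)$ that is closed under products and inverses. $\mathsf G$ *has no small subgroups* if some neighborhood of the unit contains no subgroup other than $\{e\}$. A *local group of $\mathcal C^k$-transformations on $(\mathbb R^m,0)$* consists of a local topological group $\mathsf G$, a neighborhood $\mathcal U_{\mathsf G}$ of its unit, an open connected neighborhood $\Omega\subset\mathbb R^m$ of $0$, an open connected set $\mathcal W\subset\mathcal U_{\mathsf G}\times\Omega$ containing $\mathcal U_{\mathsf G}\times\{0\}$ and $\{e\}\times\Omega$, and a continuous map $\Theta:\mathcal W\to\Omega$ such that: * $\Theta(a,\Theta(b,x))=\Theta(a\cdot b,x)$ for all $(a,b)\in(\mathcal U_{\mathsf G}\times\mathcal U_{\mathsf G})\cap\mathcal D(\mathsf G)$ and $x\in\Omega$ with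 $(b,x),(a\cdot b,x),(a,\Theta(b,x))\in\mathcal W$; * for each $a\in\mathcal U_{\mathsf G}$ the open set $\mathcal W(a)=\{x:(a,x)\in\mathcal W\}$ is connected and $\Theta(a)=\Theta(a,\cdot):\mathcal W(a)\to\Omega$ is of class $\mathcal C^k$; * $\Theta(e,x)=x$ for all $x\in\Omega$. It is *locally compact* if $\mathsf G$ is, and *effective* if $e$ is the only $a\in\mathcal U_{\mathsf G}$ for which $\Theta(a)$ is the identity on some neighborhood of $0$. **Proposition 4.3.** Let $k\in\{1,2,\dots\}\cup\{\infty\}$, $m\ge 0$, and let $(\mathsf G,\mathcal U_{\mathsf G},\Omega,\mathcal W,\Theta)$ be a locally compact local group of $\mathcal C^k$-transformations on $(\mathbb R^m,0)$. Then there are a relatively compact neighborhood $\mathcal V\subset\mathcal U_{\mathsf G}$ of the unit and an open ball $B\subset\Omega$ of positive radius centered at $0$ such that: for every subgroup $\mathsf H$ of $\mathsf G$ with $\mathsf H\subset\mathcal V$ there is an open neighborhood $V_{\mathrm o}\subset B$ of $0$ such that, for every $a\in\mathsf H$, one has $V_{\mathrm o}\subset\mathcal W(a)$ and $\Theta(a)|_{V_{\mathrm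 o}}=\mathrm{Id}_{V_{\mathrm o}}$. Consequently, if in addition the local group of transformations is effective, then $\mathsf G$ has no small subgroups. -/

import Mathlib

open Set Topology

/-- A local topological group on a Hausdorff space `G`. The partially defined operations
are encoded by total functions, of which only the values on the domains `J` (inversion) and `D`
(multiplication) are constrained or ever used. -/
structure LocalTopologicalGroup (G : Type*) [TopologicalSpace G] [T2Space G] where
  /-- the unit -/
  e : G
  /-- the domain of the inversion -/
  J : Set G
  /-- the domain of the multiplication -/
  D : Set (G × G)
  /-- the inversion -/
  inv : G → G
  /-- the multiplication -/
  mul : G → G → G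
  J_mem_nhds : J ∈ 𝓝 e
  isOpen_D : IsOpen D
  right_unit_mem_D : ∀ a, (a, e) ∈ D
  left_unit_mem_D : ∀ a, (e, a) ∈ D
  continuousOn_inv : ContinuousOn inv J
  continuousOn_mul : ContinuousOn (fun q : G × G => mul q.1 q.2) D
  mul_e : ∀ a, mul a e = a
  e_mul : ∀ a, mul e a = a
  mul_assoc : ∀ a₁ a a₂, (a₁, a) ∈ D → (a, a₂) ∈ D → (a₁, mul a a₂) ∈ D → (mul a₁ a, a₂) ∈ D →
    mul a₁ (mul a a₂) = mul (mul a₁ a) a₂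
  right_inv_mem_D : ∀ b ∈ J, (b, inv b) ∈ D
  left_inv_mem_D : ∀ b ∈ J, (inv b, b) ∈ D
  mul_inv : ∀ b ∈ J, mul b (inv b) = e
  inv_mul : ∀ b ∈ J, mul (inv b) b = e

namespace LocalTopologicalGroup

variable {G : Type*} [TopologicalSpace G] [T2Space G] (L : LocalTopologicalGroup G)

/-- The domain `J(U) = J ∩ U ∩ inv⁻¹(U)` of the inversion of the restriction of `L` to `U`. -/
def restrictJ (U : Set G) : Set G :=
  {a | a ∈ L.J ∧ a ∈ U ∧ L.inv a ∈ U}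

/-- The domain `D(U) = D ∩ (U × U) ∩ mul⁻¹(U)` of the multiplication of the restriction of `L`
to `U`. -/
def restrictD (U : Set G) : Set (G × G) :=
  {q | q ∈ L.D ∧ q.1 ∈ U ∧ q.2 ∈ U ∧ L.mul q.1 q.2 ∈ U}

/-- `U` is symmetric: `U = J(U)`. -/
def IsSymmetric (U : Set G) : Prop :=
  U = L.restrictJ U

/-- `U` is cancellative. -/
structure IsCancellative (U : Set G) : Prop where
  left_cancel : ∀ a ∈ U, ∀ a₁ ∈ U, ∀ a₂ ∈ U, (a, a₁) ∈ L.restrictD U → (a, a₂) ∈ L.restrictD U →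
    L.mul a a₁ = L.mul a a₂ → a₁ = a₂
  right_cancel : ∀ a ∈ U, ∀ a₁ ∈ U, ∀ a₂ ∈ U, (a₁, a) ∈ L.restrictD U → (a₂, a) ∈ L.restrictD U →
    L.mul a₁ a = L.mul a₂ a → a₁ = a₂
  mul_inv_rev : ∀ a₁ ∈ U, ∀ a₂ ∈ U, (a₁, a₂) ∈ L.restrictD U →
    (L.inv a₂, L.inv a₁) ∈ L.restrictD U ∧
      L.inv (L.mul a₁ a₂) = L.mul (L.inv a₂) (L.inv a₁)

/-- (Open) neighborhoods of the unit; they are always taken symmetric and cancellative. -/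
structure IsUnitNeighborhood (U : Set G) : Prop where
  isOpen : IsOpen U
  e_mem : L.e ∈ U
  symmetric : L.IsSymmetric U
  cancellative : L.IsCancellative U

/-- `H` is a sub-local group with associated (open) neighborhood `𝒱`. -/
structure IsSubLocalGroup (H 𝒱 : Set G) : Prop where
  e_mem : L.e ∈ H
  isOpen : IsOpen 𝒱
  subset : H ⊆ 𝒱
  subset_J : H ⊆ L.J
  inv_mem : ∀ a ∈ H, L.inv a ∈ 𝒱 → L.inv a ∈ H
  mul_mem : ∀ a₁ ∈ H, ∀ a₂ ∈ H, (a₁, a₂) ∈ L.D → L.mul a₁ a₂ ∈ 𝒱 → L.mul a₁ a₂ ∈ H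

/-- `H` is a subgroup: all products of elements of `H` are defined, and `H` is a sub-local group
with associated neighborhood the whole of `G`. -/
def IsSubgroup (H : Set G) : Prop :=
  H ×ˢ H ⊆ L.D ∧ L.IsSubLocalGroup H univ

/-- `L` has no small subgroups: some neighborhood of the unit contains only the trivial
subgroup. -/
def HasNoSmallSubgroups : Prop :=
  ∃ V : Set G, L.IsUnitNeighborhood V ∧ ∀ H : Set G, L.IsSubgroup H → H ⊆ V → H = {L.e}

end LocalTopologicalGroup

/-- A local topological group of `C^k`-transformations on the pointed manifold `(ℝᵐ, 0)`,
with underlying local topological group `L`. Only the values of `Θ` on `W` are constrained or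
ever used. -/
structure LocalTransformationGroup {G : Type*} [TopologicalSpace G] [T2Space G]
    (L : LocalTopologicalGroup G) (m : ℕ) (k : ℕ∞) where
  /-- the neighborhood of the unit whose elements act -/
  U : Set G
  /-- the neighborhood of the origin -/
  Ω : Set (EuclideanSpace ℝ (Fin m))
  /-- the domain of the action -/
  W : Set (G × EuclideanSpace ℝ (Fin m))
  /-- the action -/
  Θ : G → EuclideanSpace ℝ (Fin m) → EuclideanSpace ℝ (Fin m)
  isUnitNeighborhood_U : L.IsUnitNeighborhood U
  isOpen_Ω : IsOpen Ω
  zero_mem_Ω : 0 ∈ Ω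
  isOpen_W : IsOpen W
  W_subset : W ⊆ U ×ˢ Ω
  mem_W_zero : ∀ a ∈ U, (a, 0) ∈ W
  e_mem_W : ∀ x ∈ Ω, (L.e, x) ∈ W
  mapsTo_Ω : ∀ a x, (a, x) ∈ W → Θ a x ∈ Ω
  continuousOn_Θ : ContinuousOn (fun q : G × EuclideanSpace ℝ (Fin m) => Θ q.1 q.2) W
  Θ_mul : ∀ a ∈ U, ∀ b ∈ U, (a, b) ∈ L.D → ∀ x ∈ Ω,
    (b, x) ∈ W → (L.mul a b, x) ∈ W → (a, Θ b x) ∈ W → Θ a (Θ b x) = Θ (L.mul a b) x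
  contDiffOn_Θ : ∀ a ∈ U, ContDiffOn ℝ k (Θ a) {x | (a, x) ∈ W}
  Θ_e : ∀ x ∈ Ω, Θ L.e x = x
  isConnected_Ω : IsConnected Ω
  isConnected_W : IsConnected W
  isConnected_W_apply : ∀ a ∈ U, IsConnected {x | (a, x) ∈ W}

/-- The action is effective: the unit is the only element of `U` acting as the identity on some
neighborhood of the origin. -/
def LocalTransformationGroup.IsEffective {G : Type*} [TopologicalSpace G] [T2Space G]
    {L : LocalTopologicalGroup G} {m : ℕ} {k : ℕ∞} (T : LocalTransformationGroup L m k) : Prop :=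
  {a | a ∈ T.U ∧ ∃ N : Set (EuclideanSpace ℝ (Fin m)), IsOpen N ∧ 0 ∈ N ∧
    ∀ x ∈ N, (a, x) ∈ T.W ∧ T.Θ a x = x} = {L.e}

/-!
The transformations near the unit are equi-Lipschitz close to the identity: for `a` in some
neighborhood of `e`, the map `Θ a - id` is `1/2`-Lipschitz on a fixed ball around `0`
(`exists_lipschitz_sub_id`). No continuity of the derivative of `Θ a` in `a` is assumed; it is
replaced by a Baire category argument. Every `a` near `e` satisfies, for some `B` in a countable
dense set of linear maps and some radius `ρ` in a sequence tending to `0`, that `B ∘ Θ a - id` is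
`1/5`-Lipschitz on `ball 0 ρ` (take `B` close to the inverse of the derivative of `Θ a` at `0`).
These conditions are closed in `a`, so for one choice of `B` and `ρ` they hold on a neighborhood of
some `a₀`. Comparing `Θ a₀ ∘ Θ c = Θ (a₀ c)` with `Θ a₀` eliminates `B` and bounds `Θ c - id` for
all `c` close to `e`.

If now `c` belongs to a subgroup contained in that neighborhood, the averages
`Fₙ = n⁻¹ ∑_{i < n} Θ (cⁱ)` also differ from the identity by a `1/2`-Lipschitz map, while
`Fₙ (Θ c x) - Fₙ x = n⁻¹ (Θ (cⁿ) x - x)` tends to `0`. Hence `Θ c x = x`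
(`eq_of_shift_of_lipschitz`).
-/

open Filter Metric

/-! ### Symmetric neighborhoods of the unit -/

namespace LocalTopologicalGroup

variable {G : Type*} [TopologicalSpace G] [T2Space G] {L : LocalTopologicalGroup G}

lemma IsSymmetric.mem_J {U : Set G} (h : L.IsSymmetric U) {a : G} (ha : a ∈ U) : a ∈ L.J := by
  rw [h] at ha
  exact ha.1

lemma IsSymmetric.inv_mem {U : Set G} (h : L.IsSymmetric U) {a : G} (ha : a ∈ U) :
    L.inv a ∈ U := by
  rw [h] at ha
  exact ha.2.2

lemma inv_e : L.inv L.e = L.e := by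
  rw [← L.e_mul (L.inv L.e)]
  exact L.mul_inv _ (mem_of_mem_nhds L.J_mem_nhds)

lemma inv_inv (hL : L.IsUnitNeighborhood univ) (a : G) : L.inv (L.inv a) = a := by
  have hJ : ∀ b, b ∈ L.J := fun b => hL.symmetric.mem_J (mem_univ b)
  refine hL.cancellative.right_cancel (L.inv a) trivial _ trivial _ trivial
    ⟨L.left_inv_mem_D _ (hJ _), trivial, trivial, trivial⟩
    ⟨L.right_inv_mem_D _ (hJ _), trivial, trivial, trivial⟩ ?_
  rw [L.inv_mul _ (hJ _), L.mul_inv _ (hJ _)]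

lemma continuous_inv (hL : L.IsUnitNeighborhood univ) : Continuous L.inv := by
  rw [← continuousOn_univ]
  exact L.continuousOn_inv.mono fun a ha => hL.symmetric.mem_J ha

lemma exists_isUnitNeighborhood_subset (hL : L.IsUnitNeighborhood univ) {O : Set G}
    (hO : IsOpen O) (he : L.e ∈ O) : ∃ V, L.IsUnitNeighborhood V ∧ V ⊆ O := by
  have hinv : ∀ a ∈ O ∩ L.inv ⁻¹' O, L.inv a ∈ O ∩ L.inv ⁻¹' O := fun a ha =>
    ⟨ha.2, by simpa only [mem_preimage, inv_inv hL] using ha.1⟩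
  have hD : ∀ {q : G × G} {U : Set G}, q ∈ L.restrictD U → q ∈ L.restrictD univ :=
    fun h => ⟨h.1, trivial, trivial, trivial⟩
  refine ⟨O ∩ L.inv ⁻¹' O, ⟨hO.inter (hO.preimage (continuous_inv hL)), ?_, ?_, ?_, ?_, ?_⟩,
    inter_subset_left⟩
  · exact ⟨he, by simpa only [mem_preimage, inv_e] using he⟩
  · exact Subset.antisymm
      (fun a ha => ⟨hL.symmetric.mem_J (mem_univ a), ha, hinv a ha⟩) fun a ha => ha.2.1
  · exact fun a _ a₁ _ a₂ _ h₁ h₂ =>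
      hL.cancellative.left_cancel a trivial a₁ trivial a₂ trivial (hD h₁) (hD h₂)
  · exact fun a _ a₁ _ a₂ _ h₁ h₂ =>
      hL.cancellative.right_cancel a trivial a₁ trivial a₂ trivial (hD h₁) (hD h₂)
  · intro a₁ h₁ a₂ h₂ h
    obtain ⟨hd, heq⟩ := hL.cancellative.mul_inv_rev a₁ trivial a₂ trivial (hD h)
    exact ⟨⟨hd.1, hinv _ h₂, hinv _ h₁, heq ▸ hinv _ h.2.2.2⟩, heq⟩

end LocalTopologicalGroup

/-! ### Averages along a cyclic semigroup -/

/-- If `f i` plays the role of the `i`-th power of a transformation sending `x` to `y`, the orbit of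
`x` is bounded and every `f i - id` contracts the pair `x, y` by the factor `1/2`, then `y = x`. -/
lemma eq_of_shift_of_lipschitz {E : Type*} [NormedAddCommGroup E] [NormedSpace ℝ E]
    {f : ℕ → E → E} {x y : E} {C : ℝ} (h0 : f 0 x = x) (hshift : ∀ i, f i y = f (i + 1) x)
    (hlip : ∀ i, ‖(f i y - y) - (f i x - x)‖ ≤ 1 / 2 * ‖y - x‖)
    (hC : ∀ i, ‖f i x - x‖ ≤ C) : y = x := by
  have hsum : ∀ n : ℕ, ∑ i ∈ Finset.range n, ((f i y - y) - (f i x - x)) =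
      (f n x - x) - (n : ℝ) • (y - x) := by
    intro n
    induction n with
    | zero => simp [h0]
    | succ n ih =>
      rw [Finset.sum_range_succ, ih, hshift]
      push_cast
      module
  have hn : ∀ n : ℕ, (n : ℝ) * ‖y - x‖ ≤ 2 * C := by
    intro n
    have h1 : ‖(f n x - x) - (n : ℝ) • (y - x)‖ ≤ n * (1 / 2 * ‖y - x‖) := by
      rw [← hsum]
      refine (norm_sum_le_of_le _ fun i _ => hlip i).trans_eq ?_
      simp
    have h2 : ‖(n : ℝ) • (y - x)‖ = n * ‖y - x‖ := by simp [norm_smul]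
    have h3 := norm_sub_norm_le ((n : ℝ) • (y - x)) (f n x - x)
    rw [norm_sub_rev _ (f n x - x)] at h3
    linarith [hC n]
  by_contra hne
  have hpos : 0 < ‖y - x‖ := norm_pos_iff.2 (sub_ne_zero.2 hne)
  obtain ⟨n, hlt⟩ := exists_nat_gt (2 * C / ‖y - x‖)
  rw [div_lt_iff₀ hpos] at hlt
  exact absurd (hn n) hlt.not_ge

/-! ### Equi-Lipschitz estimates near the unit -/

namespace LocalTransformationGroup

variable {G : Type*} [TopologicalSpace G] [T2Space G] {L : LocalTopologicalGroup G}
  {m : ℕ} {k : ℕ∞} (T : LocalTransformationGroup L m k)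

lemma continuousAt_Θ {a : G} {x : EuclideanSpace ℝ (Fin m)} (h : (a, x) ∈ T.W) :
    ContinuousAt (fun q : G × EuclideanSpace ℝ (Fin m) => T.Θ q.1 q.2) (a, x) :=
  T.continuousOn_Θ.continuousAt (T.isOpen_W.mem_nhds h)

lemma e_zero_mem_W : (L.e, (0 : EuclideanSpace ℝ (Fin m))) ∈ T.W :=
  T.e_mem_W 0 T.zero_mem_Ω

lemma continuousAt_Θ_apply {a : G} {x : EuclideanSpace ℝ (Fin m)} (h : (a, x) ∈ T.W) :
    ContinuousAt (T.Θ a) x :=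
  (T.continuousAt_Θ h).comp (f := fun y => (a, y)) (by fun_prop)

lemma hasStrictFDerivAt_Θ (hk : 1 ≤ k) {a : G} {x : EuclideanSpace ℝ (Fin m)}
    (h : (a, x) ∈ T.W) : HasStrictFDerivAt (T.Θ a) (fderiv ℝ (T.Θ a) x) x := by
  have hopen : IsOpen {x | (a, x) ∈ T.W} := T.isOpen_W.preimage (by fun_prop)
  have hc : ContDiffAt ℝ k (T.Θ a) x :=
    (T.contDiffOn_Θ a (T.W_subset h).1).contDiffAt (hopen.mem_nhds h)
  refine hc.hasStrictFDerivAt ?_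
  have : k ≠ 0 := fun h => by simp [h] at hk
  exact_mod_cast this

/-- The domain condition on `Θ (a⁻¹)` makes `Θ (a⁻¹)` a left inverse of `Θ a` near `0`, so that
`B` can be chosen close to the inverse of the derivative of `Θ a` at `0`. -/
lemma exists_eventually_lipschitz_comp_sub_id (hk : 1 ≤ k) {a : G} (ha : a ∈ T.U)
    (hW : (L.inv a, T.Θ a 0) ∈ T.W)
    {S : Set (EuclideanSpace ℝ (Fin m) →L[ℝ] EuclideanSpace ℝ (Fin m))} (hS : Dense S)
    {δ : ℝ} (hδ : 0 < δ) :
    ∃ B ∈ S, ∀ᶠ p : EuclideanSpace ℝ (Fin m) × EuclideanSpace ℝ (Fin m) in 𝓝 (0, 0),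
      ‖B (T.Θ a p.1 - T.Θ a p.2) - (p.1 - p.2)‖ ≤ δ * ‖p.1 - p.2‖ := by
  have haW := T.mem_W_zero a ha
  have hsym := T.isUnitNeighborhood_U.symmetric
  set A := fderiv ℝ (T.Θ a) 0
  set A' := fderiv ℝ (T.Θ (L.inv a)) (T.Θ a 0)
  have hA : HasStrictFDerivAt (T.Θ a) A 0 := T.hasStrictFDerivAt_Θ hk haW
  have hA' : HasStrictFDerivAt (T.Θ (L.inv a)) A' (T.Θ a 0) := T.hasStrictFDerivAt_Θ hk hW
  have hinv : A' ∘L A = ContinuousLinearMap.id ℝ _ := by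
    refine (hA'.comp 0 hA).hasFDerivAt.unique ((hasFDerivAt_id _).congr_of_eventuallyEq ?_)
    have h1 : ∀ᶠ x in 𝓝 (0 : EuclideanSpace ℝ (Fin m)), (a, x) ∈ T.W :=
      (T.isOpen_W.preimage (by fun_prop : Continuous fun x => (a, x))).mem_nhds haW
    have h2 : ∀ᶠ x in 𝓝 (0 : EuclideanSpace ℝ (Fin m)), (L.inv a, T.Θ a x) ∈ T.W :=
      (T.continuousAt_Θ_apply haW).eventually
        ((T.isOpen_W.preimage (by fun_prop : Continuous fun x => (L.inv a, x))).mem_nhds hW)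
    filter_upwards [h1, h2, T.isOpen_Ω.mem_nhds T.zero_mem_Ω] with x hx1 hx2 hx3
    have hJ := hsym.mem_J ha
    have hx := T.Θ_mul (L.inv a) (hsym.inv_mem ha) a ha (L.left_inv_mem_D a hJ) x hx3 hx1
      (by rw [L.inv_mul a hJ]; exact T.e_mem_W x hx3) hx2
    rw [L.inv_mul a hJ, T.Θ_e x hx3] at hx
    exact hx
  -- `B ∘L A` is within `δ / 2` of the identity, which leaves `δ / 2` for the linearization error.
  have hopen : IsOpen {B : EuclideanSpace ℝ (Fin m) →L[ℝ] EuclideanSpace ℝ (Fin m) |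
      ‖B ∘L A - ContinuousLinearMap.id ℝ _‖ < δ / 2} :=
    isOpen_lt (by fun_prop) continuous_const
  obtain ⟨B, hB, hBS⟩ := hS.inter_open_nonempty _ hopen ⟨A', by simp [hinv, hδ]⟩
  refine ⟨B, hBS, ?_⟩
  have hlin := (B.hasStrictFDerivAt.comp 0 hA).isLittleO.def (half_pos hδ)
  filter_upwards [hlin] with p hp
  have h1 : ‖(B ∘L A - ContinuousLinearMap.id ℝ (EuclideanSpace ℝ (Fin m))) (p.1 - p.2)‖ ≤
      δ / 2 * ‖p.1 - p.2‖ :=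
    ContinuousLinearMap.le_of_opNorm_le _ hB.le _
  calc ‖B (T.Θ a p.1 - T.Θ a p.2) - (p.1 - p.2)‖
      = ‖(B (T.Θ a p.1) - B (T.Θ a p.2) - (B ∘L A) (p.1 - p.2)) +
          (B ∘L A - ContinuousLinearMap.id ℝ (EuclideanSpace ℝ (Fin m))) (p.1 - p.2)‖ := by
        congr 1
        simp only [map_sub, _root_.sub_apply, ContinuousLinearMap.id_apply]
        abel
    _ ≤ δ / 2 * ‖p.1 - p.2‖ + δ / 2 * ‖p.1 - p.2‖ := (norm_add_le _ _).trans (add_le_add hp h1)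
    _ = δ * ‖p.1 - p.2‖ := by ring

/-- The set on which the Baire category theorem produces an interior point. -/
lemma isClosed_setOf_lipschitz_comp_sub_id {K : Set G} (hK : IsClosed K) {ρ : ℝ}
    (hW : ∀ a ∈ K, ∀ x ∈ ball (0 : EuclideanSpace ℝ (Fin m)) ρ, (a, x) ∈ T.W)
    (B : EuclideanSpace ℝ (Fin m) →L[ℝ] EuclideanSpace ℝ (Fin m)) (δ : ℝ) :
    IsClosed {a | a ∈ K ∧ ∀ x ∈ ball (0 : EuclideanSpace ℝ (Fin m)) ρ,
      ∀ y ∈ ball (0 : EuclideanSpace ℝ (Fin m)) ρ,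
        ‖B (T.Θ a x - T.Θ a y) - (x - y)‖ ≤ δ * ‖x - y‖} := by
  have hcont : ∀ x ∈ ball (0 : EuclideanSpace ℝ (Fin m)) ρ, ContinuousOn (fun a => T.Θ a x) K :=
    fun x hx => T.continuousOn_Θ.comp (f := fun a => (a, x)) (by fun_prop)
      fun a ha => hW a ha x hx
  have heq : {a | a ∈ K ∧ ∀ x ∈ ball (0 : EuclideanSpace ℝ (Fin m)) ρ,
      ∀ y ∈ ball (0 : EuclideanSpace ℝ (Fin m)) ρ,
        ‖B (T.Θ a x - T.Θ a y) - (x - y)‖ ≤ δ * ‖x - y‖} =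
      K ∩ ⋂ x ∈ ball (0 : EuclideanSpace ℝ (Fin m)) ρ,
        ⋂ y ∈ ball (0 : EuclideanSpace ℝ (Fin m)) ρ,
          {a | a ∈ K ∧ ‖B (T.Θ a x - T.Θ a y) - (x - y)‖ ≤ δ * ‖x - y‖} := by
    ext a
    simp only [mem_ofPred_eq, mem_inter_iff, mem_iInter]
    exact and_congr_right fun ha => by simp only [ha, true_and]
  rw [heq]
  refine hK.inter (isClosed_biInter fun x hx => isClosed_biInter fun y hy =>
    hK.isClosed_le ?_ continuousOn_const)
  exact ((B.continuous.comp_continuousOn ((hcont x hx).sub (hcont y hy))).sub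
    continuousOn_const).norm

lemma exists_lipschitz_sub_id [LocallyCompactSpace G] (hL : L.IsUnitNeighborhood univ)
    (hk : 1 ≤ k) :
    ∃ r : ℝ, 0 < r ∧ ∀ᶠ c in 𝓝 L.e, ∀ x ∈ ball (0 : EuclideanSpace ℝ (Fin m)) r,
      (c, x) ∈ T.W ∧ ∀ y ∈ ball (0 : EuclideanSpace ℝ (Fin m)) r,
        ‖(T.Θ c x - x) - (T.Θ c y - y)‖ ≤ 1 / 2 * ‖x - y‖ := by
  have hWe := T.isOpen_W.mem_nhds T.e_zero_mem_W
  obtain ⟨u, hu, v, hv, huv⟩ := mem_nhds_prod_iff.1 hWe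
  obtain ⟨r₀, hr₀, hball⟩ := Metric.mem_nhds_iff.1 hv
  have hUe : T.U ∈ 𝓝 L.e :=
    T.isUnitNeighborhood_U.isOpen.mem_nhds T.isUnitNeighborhood_U.e_mem
  have hΘ0 : T.Θ L.e 0 = 0 := T.Θ_e 0 T.zero_mem_Ω
  have hinv : ∀ᶠ a in 𝓝 L.e, (L.inv a, T.Θ a 0) ∈ T.W := by
    have hc : ContinuousAt (fun a => (L.inv a, T.Θ a 0)) L.e :=
      (L.continuous_inv hL).continuousAt.prodMk
        ((T.continuousAt_Θ T.e_zero_mem_W).comp (f := fun a => (a, 0)) (by fun_prop))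
    refine hc (T.isOpen_W.mem_nhds ?_)
    simp only [L.inv_e, hΘ0]
    exact T.e_zero_mem_W
  obtain ⟨K, hKe, hKsub, hK⟩ := local_compact_nhds (inter_mem (inter_mem hu hUe) hinv)
  set E := EuclideanSpace ℝ (Fin m)
  let ρ : ℕ → ℝ := fun n => r₀ / (n + 1)
  have hρ : ∀ n, 0 < ρ n := fun n => by positivity
  have hρ₀ : ∀ n, ρ n ≤ r₀ := fun n => div_le_self hr₀.le (by simp)
  let B : ℕ → E →L[ℝ] E := TopologicalSpace.denseSeq _
  let F : ℕ × ℕ → Set G := fun i => {a | a ∈ K ∧ ∀ x ∈ ball (0 : E) (ρ i.1),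
    ∀ y ∈ ball (0 : E) (ρ i.1), ‖B i.2 (T.Θ a x - T.Θ a y) - (x - y)‖ ≤ 1 / 5 * ‖x - y‖}
  have hF : ∀ i, IsClosed (F i) := fun i =>
    T.isClosed_setOf_lipschitz_comp_sub_id hK.isClosed
      (fun a ha x hx => huv ⟨(hKsub ha).1.1, hball (ball_subset_ball (hρ₀ _) hx)⟩) _ _
  have hcover : ∀ a ∈ K, ∃ i, a ∈ F i := by
    intro a ha
    obtain ⟨_, ⟨j, rfl⟩, hj⟩ := T.exists_eventually_lipschitz_comp_sub_id hk (hKsub ha).1.2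
      (hKsub ha).2 (TopologicalSpace.denseRange_denseSeq _) (δ := 1 / 5) (by norm_num)
    obtain ⟨ε, hε, hεj⟩ := Metric.eventually_nhds_iff_ball.1 hj
    obtain ⟨n, hn⟩ := exists_nat_gt (r₀ / ε)
    have hnε : ρ n ≤ ε := by
      rw [div_lt_iff₀ hε] at hn
      rw [div_le_iff₀ (by positivity)]
      nlinarith
    refine ⟨(n, j), ha, fun x hx y hy => hεj (x, y) ?_⟩
    rw [← ball_prod_same]
    exact ⟨ball_subset_ball hnε hx, ball_subset_ball hnε hy⟩
  -- The extra closed set `(interior K)ᶜ` turns the cover of `K` into a cover of `G`.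
  have hdense : Dense (⋃ i : Option (ℕ × ℕ), interior (i.elim (interior K)ᶜ F)) := by
    refine dense_iUnion_interior_of_closed ?_ (eq_univ_of_forall fun a => mem_iUnion.2 ?_)
    · rintro (_ | i)
      · exact isOpen_interior.isClosed_compl
      · exact hF i
    · by_cases ha : a ∈ interior K
      · obtain ⟨i, hi⟩ := hcover a (interior_subset ha)
        exact ⟨some i, hi⟩
      · exact ⟨none, ha⟩
  obtain ⟨a₀, ha₀K, ha₀⟩ := hdense.inter_open_nonempty _ isOpen_interior
    ⟨L.e, mem_interior_iff_mem_nhds.2 hKe⟩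
  obtain ⟨_ | i, hi⟩ := mem_iUnion.1 ha₀
  · exact absurd ha₀K (interior_subset hi)
  change a₀ ∈ interior (F i) at hi
  have ha₀F : a₀ ∈ F i := interior_subset hi
  have hD := L.isOpen_D.mem_nhds (L.right_unit_mem_D a₀)
  have hDe : ∀ᶠ c in 𝓝 L.e, (a₀, c) ∈ L.D :=
    (by fun_prop : Continuous fun c => (a₀, c)).continuousAt hD
  have hmul : ∀ᶠ c in 𝓝 L.e, L.mul a₀ c ∈ F i := by
    have hc : ContinuousAt (fun c => L.mul a₀ c) L.e :=
      (L.continuousOn_mul.continuousAt hD).comp (f := fun c => (a₀, c)) (by fun_prop)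
    exact hc (by simp only [L.mul_e]; exact mem_interior_iff_mem_nhds.1 hi)
  have hΘ : ∀ᶠ q : G × E in 𝓝 (L.e, 0), T.Θ q.1 q.2 ∈ ball (0 : E) (ρ i.1) := by
    refine T.continuousAt_Θ T.e_zero_mem_W ?_
    simp only [hΘ0]
    exact ball_mem_nhds _ (hρ _)
  obtain ⟨u', hu', v', hv', huv'⟩ := mem_nhds_prod_iff.1 (inter_mem hΘ hWe)
  obtain ⟨r, hr, hrv⟩ := Metric.mem_nhds_iff.1 (inter_mem hv' (ball_mem_nhds (0 : E) (hρ i.1)))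
  refine ⟨r, hr, ?_⟩
  filter_upwards [hu', hDe, hmul] with c hcu hcD hcF
  have key : ∀ x ∈ ball (0 : E) r, (c, x) ∈ T.W ∧ x ∈ ball (0 : E) (ρ i.1) ∧
      T.Θ c x ∈ ball (0 : E) (ρ i.1) ∧ T.Θ a₀ (T.Θ c x) = T.Θ (L.mul a₀ c) x := by
    intro x hx
    obtain ⟨hxv, hxρ⟩ := hrv hx
    obtain ⟨hΘx, hWx⟩ := huv' (mk_mem_prod hcu hxv)
    have hWK : ∀ a ∈ F i, ∀ z ∈ ball (0 : E) (ρ i.1), (a, z) ∈ T.W := fun a ha z hz =>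
      huv ⟨(hKsub ha.1).1.1, hball (ball_subset_ball (hρ₀ _) hz)⟩
    exact ⟨hWx, hxρ, hΘx, T.Θ_mul a₀ (hKsub ha₀F.1).1.2 c (T.W_subset hWx).1 hcD x
      (T.W_subset hWx).2 hWx (hWK _ hcF x hxρ) (hWK _ ha₀F _ hΘx)⟩
  refine fun x hx => ⟨(key x hx).1, fun y hy => ?_⟩
  obtain ⟨-, hx1, hx2, hx3⟩ := key x hx
  obtain ⟨-, hy1, hy2, hy3⟩ := key y hy
  -- The same vector `B (Θ (a₀ c) x - Θ (a₀ c) y)` is close to both differences, `x - y` and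
  -- `Θ c x - Θ c y`; the constant `1 / 5` is the one with `2 δ / (1 - δ) = 1 / 2`.
  have h1 := ha₀F.2 _ hx2 _ hy2
  have h2 := hcF.2 x hx1 y hy1
  rw [hx3, hy3] at h1
  set w := B i.2 (T.Θ (L.mul a₀ c) x - T.Θ (L.mul a₀ c) y)
  have e1 : (T.Θ c x - x) - (T.Θ c y - y) = (w - (x - y)) - (w - (T.Θ c x - T.Θ c y)) := by abel
  have e2 : T.Θ c x - T.Θ c y = ((T.Θ c x - x) - (T.Θ c y - y)) + (x - y) := by abel
  have h3 := norm_sub_le (w - (x - y)) (w - (T.Θ c x - T.Θ c y))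
  have h4 := norm_add_le ((T.Θ c x - x) - (T.Θ c y - y)) (x - y)
  rw [← e1] at h3
  rw [← e2] at h4
  linarith

/-- A subgroup acting by maps `Θ a` with `Θ a - id` being `1/2`-Lipschitz on a ball fixes every
point whose orbit stays in that ball. -/
lemma apply_eq_self_of_isSubgroup {H : Set G} (hH : L.IsSubgroup H) {r : ℝ}
    (hlip : ∀ a ∈ H, ∀ z ∈ ball (0 : EuclideanSpace ℝ (Fin m)) r,
      (a, z) ∈ T.W ∧ ∀ y ∈ ball (0 : EuclideanSpace ℝ (Fin m)) r,
        ‖(T.Θ a z - z) - (T.Θ a y - y)‖ ≤ 1 / 2 * ‖z - y‖)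
    {x : EuclideanSpace ℝ (Fin m)} (hx : x ∈ ball (0 : EuclideanSpace ℝ (Fin m)) r)
    (horbit : ∀ a ∈ H, T.Θ a x ∈ ball (0 : EuclideanSpace ℝ (Fin m)) r)
    {c : G} (hc : c ∈ H) : T.Θ c x = x := by
  have hW : ∀ a ∈ H, (a, x) ∈ T.W := fun a ha => (hlip a ha x hx).1
  have hU : ∀ a ∈ H, a ∈ T.U := fun a ha => (T.W_subset (hW a ha)).1
  have hΩ : x ∈ T.Ω := (T.W_subset (hW c hc)).2
  obtain ⟨p, hp0, hps⟩ : ∃ p : ℕ → G, p 0 = L.e ∧ ∀ n, p (n + 1) = L.mul (p n) c :=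
    ⟨fun n => Nat.rec L.e (fun _ b => L.mul b c) n, rfl, fun _ => rfl⟩
  have hp : ∀ n, p n ∈ H := by
    intro n
    induction n with
    | zero => exact hp0 ▸ hH.2.e_mem
    | succ n ih =>
      rw [hps]
      exact hH.2.mul_mem _ ih _ hc (hH.1 (mk_mem_prod ih hc)) trivial
  refine eq_of_shift_of_lipschitz (f := fun n => T.Θ (p n)) (C := 2 * r) ?_ ?_ ?_ ?_
  · simp only [hp0, T.Θ_e x hΩ]
  · intro n
    have hn := hW _ (hp (n + 1))
    simp only [hps] at hn ⊢
    exact T.Θ_mul _ (hU _ (hp n)) c (hU c hc) (hH.1 (mk_mem_prod (hp n) hc)) x hΩ (hW c hc) hn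
      (hlip _ (hp n) _ (horbit c hc)).1
  · exact fun n => (hlip _ (hp n) _ (horbit c hc)).2 x hx
  · intro n
    have h1 := mem_ball_zero_iff.1 (horbit _ (hp n))
    have h2 := mem_ball_zero_iff.1 hx
    linarith [norm_sub_le (T.Θ (p n) x) x]

end LocalTransformationGroup

/-! ### Small subgroups act trivially -/

theorem proposition4p3 {G : Type*} [TopologicalSpace G] [T2Space G] [LocallyCompactSpace G]
    (L : LocalTopologicalGroup G) (hL : L.IsUnitNeighborhood univ)
    (m : ℕ) (k : ℕ∞) (hk : 1 ≤ k) (T : LocalTransformationGroup L m k) :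
    (∃ (V : Set G) (r : ℝ),
      L.IsUnitNeighborhood V ∧ V ⊆ T.U ∧ IsCompact (closure V) ∧
      0 < r ∧ Metric.ball (0 : EuclideanSpace ℝ (Fin m)) r ⊆ T.Ω ∧
      ∀ H : Set G, L.IsSubgroup H → H ⊆ V →
        ∃ N : Set (EuclideanSpace ℝ (Fin m)), IsOpen N ∧ 0 ∈ N ∧ N ⊆ Metric.ball 0 r ∧
          ∀ a ∈ H, ∀ x ∈ N, (a, x) ∈ T.W ∧ T.Θ a x = x) ∧
    (T.IsEffective → L.HasNoSmallSubgroups) := by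
  obtain ⟨r, hr, hlip⟩ := T.exists_lipschitz_sub_id hL hk
  have hΘ : ∀ᶠ q : G × EuclideanSpace ℝ (Fin m) in 𝓝 (L.e, 0),
      T.Θ q.1 q.2 ∈ ball (0 : EuclideanSpace ℝ (Fin m)) r := by
    refine T.continuousAt_Θ T.e_zero_mem_W ?_
    simp only [T.Θ_e 0 T.zero_mem_Ω]
    exact ball_mem_nhds _ hr
  obtain ⟨u, hu, v, hv, huv⟩ := mem_nhds_prod_iff.1 hΘ
  obtain ⟨s, hs, hsv⟩ :=
    Metric.mem_nhds_iff.1 (inter_mem hv (ball_mem_nhds (0 : EuclideanSpace ℝ (Fin m)) hr))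
  obtain ⟨K, hK, hKe⟩ := exists_compact_mem_nhds L.e
  have hUe : T.U ∈ 𝓝 L.e :=
    T.isUnitNeighborhood_U.isOpen.mem_nhds T.isUnitNeighborhood_U.e_mem
  obtain ⟨O, hO, hOopen, heO⟩ :=
    eventually_nhds_iff.1 (hlip.and ((eventually_mem_set.2 hu).and
      ((eventually_mem_set.2 hKe).and (eventually_mem_set.2 hUe))))
  obtain ⟨V, hV, hVO⟩ := L.exists_isUnitNeighborhood_subset hL hOopen heO
  have hfix : ∀ H : Set G, L.IsSubgroup H → H ⊆ V →
      ∀ a ∈ H, ∀ x ∈ ball (0 : EuclideanSpace ℝ (Fin m)) s, (a, x) ∈ T.W ∧ T.Θ a x = x := by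
    intro H hH hHV c hc x hx
    have hlipH := fun a (ha : a ∈ H) => (hO a (hVO (hHV ha))).1
    obtain ⟨hxv, hxr⟩ := hsv hx
    have horbit : ∀ a ∈ H, T.Θ a x ∈ ball (0 : EuclideanSpace ℝ (Fin m)) r := by
      intro a ha
      have h := huv (mk_mem_prod (hO a (hVO (hHV ha))).2.1 hxv)
      exact h
    exact ⟨(hlipH c hc x hxr).1, T.apply_eq_self_of_isSubgroup hH hlipH hxr horbit hc⟩
  have hVU : V ⊆ T.U := fun a ha => (hO a (hVO ha)).2.2.2
  refine ⟨⟨V, r, hV, hVU, hK.closure_of_subset fun a ha => (hO a (hVO ha)).2.2.1, hr,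
    fun x hx => (T.W_subset ((hO L.e heO).1 x hx).1).2, fun H hH hHV => ⟨ball 0 s, isOpen_ball,
      mem_ball_self hs, fun x hx => (hsv hx).2, hfix H hH hHV⟩⟩, fun heff => ⟨V, hV, ?_⟩⟩
  refine fun H hH hHV => Subset.antisymm (fun a ha => ?_) (singleton_subset_iff.2 hH.2.e_mem)
  rw [← heff]
  exact ⟨hVU (hHV ha), ball 0 s, isOpen_ball, mem_ball_self hs, hfix H hH hHV a ha⟩
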